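/- In the PAIRCOND model over $[N]=\{1,\dots,N\}$, an algorithm has access to an unknown distribution $\mathcal D$ on $[N]$ through two oracles, which it may query adaptively and in any order, using internal randomness. A query to SAMP returns $i\in[N]$ with probability $D(i)$. A query to PCOND on $x,y\in[N]$ returns a sample from $\mathcal D$ conditioned on $\{x,y\}$, that is, for $x\neq y$, it returns $x$ with probability $\frac{D(x)}{D(x)+D(y)}$ and $y$ with probability $\frac{D(y)}{D(x)+D(y)}$. All answers are independent given the queries. Call a distribution fully supported if all its probabilities are nonzero, so that every query makes sense. For a fully supported distribution $\mathcal D^*$ on $[N]$ and $\varepsilon>0$, an identity tester for $\mathcal D^*$ with error parameter $\varepsilon$ is such an algorithm that outputs ACCEPT with probability at least $2/3$ if $\mathcal D=\mathcal D^*$, and outputs REJECT with probability at least $2/3$ if $\mathcal D$ is fully supported and $d_{\mathrm{TV}}(\mathcal D,\mathcal D^*)=\frac12\sum_{i=1}^N|D(i)-D^*(i)|\ge\varepsilon$. (Every algorithm that is correct on all distributions, under whatever convention for pairs of mass zero, is in particular such a tester.) **Theorem.** For every $\varepsilon_0\in(0,1)$ there is a constant $c>0$ such that for every integer $N\ge 3$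 and every $\varepsilon\in(0,\varepsilon_0]$ there exists a fully supported distribution $\mathcal D^*$ on $[N]$ with the following property: if an identity tester for $\mathcal D^*$ with error parameter $\varepsilon$ makes at most $q$ queries (to SAMP and PCOND together) on every execution, then $$q\;\ge\; c\,\sqrt{\frac{\log N}{\log(\varepsilon^{-1}\log N)}}\cdot\varepsilon^{-2}.$$ -/

import Mathlib

open scoped ENNReal

noncomputable section

namespace PairCond

/-- The answer of the pair-conditional sampling oracle for the distribution `D` on the query
`x, y`: a sample from `D` conditioned on `{x, y}`. A pair of mass zero, on which the conditional
distribution does not exist, is answered uniformly; this convention plays no role for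
distributions that charge every point. -/
def pcond {N : ℕ} (D : PMF (Fin N)) (x y : Fin N) : PMF (Fin N) :=
  open Classical in
  if h : ∃ a ∈ ({x, y} : Set (Fin N)), a ∈ D.support then D.filter {x, y} h
  else PMF.uniformOfFinset ({x, y} : Finset (Fin N)) ⟨x, Finset.mem_insert_self x {y}⟩

/-- A deterministic adaptive algorithm in the PAIRCOND model over `Fin N`, as a decision tree.
At each step it outputs a verdict (`true` is ACCEPT, `false` is REJECT), or draws a sample from the
unknown distribution, or makes a pair-conditional query; the continuation depends on the answer. -/
inductive DetAlg (N : ℕ) : Type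
  | output (verdict : Bool) : DetAlg N
  | samp (next : Fin N → DetAlg N) : DetAlg N
  | pcond (x y : Fin N) (next : Fin N → DetAlg N) : DetAlg N

/-- The distribution of the verdict when the algorithm runs on the unknown distribution `D`;
the oracle answers are independent. -/
def DetAlg.run {N : ℕ} (D : PMF (Fin N)) : DetAlg N → PMF Bool
  | .output b => PMF.pure b
  | .samp next => D.bind fun i => (next i).run D
  | .pcond x y next => (PairCond.pcond D x y).bind fun i => (next i).run D

/-- The largest number of oracle queries (of both kinds together) on any execution path. A
pair-conditional query on `x, y` can only be answered by `x` or `y`. -/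
def DetAlg.queries {N : ℕ} : DetAlg N → ℕ
  | .output _ => 0
  | .samp next => 1 + Finset.univ.sup fun i => (next i).queries
  | .pcond x y next => 1 + max (next x).queries (next y).queries

/-- A randomized adaptive algorithm in the PAIRCOND model: its internal randomness, which is
independent of the oracle answers, picks a decision tree. (There are only countably many trees, so
that every random tree has such a law.) -/
abbrev Alg (N : ℕ) : Type := PMF (DetAlg N)

/-- The distribution of the verdict of a randomized algorithm on the unknown distribution `D`. -/
def Alg.run {N : ℕ} (A : Alg N) (D : PMF (Fin N)) : PMF Bool :=
  PMF.bind A fun t => t.run D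

/-- On every execution, the algorithm makes at most `q` oracle queries. -/
def Alg.MakesAtMost {N : ℕ} (A : Alg N) (q : ℕ) : Prop :=
  ∀ t ∈ PMF.support A, t.queries ≤ q

/-- Total variation distance between two distributions on `Fin N`. -/
def tvDist {N : ℕ} (P Q : PMF (Fin N)) : ℝ :=
  1 / 2 * ∑ i, |(P i).toReal - (Q i).toReal|

/-- All probabilities are nonzero, so that every conditional query makes sense. -/
def FullSupport {N : ℕ} (D : PMF (Fin N)) : Prop := ∀ i, D i ≠ 0

/-- `A` is an identity tester for `Dstar` with error parameter `ε`: it outputs ACCEPT with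
probability at least `2/3` if the unknown distribution is `Dstar`, and REJECT with probability at
least `2/3` if the unknown distribution is at distance at least `ε` from `Dstar`. Correctness is
demanded only on unknown distributions of full support, which makes being a tester a weaker
property than correctness on all distributions, whatever the oracle does on pairs of mass zero. -/
structure IsIdentityTester {N : ℕ} (A : Alg N) (Dstar : PMF (Fin N)) (ε : ℝ) : Prop where
  accept : (2 / 3 : ℝ≥0∞) ≤ A.run Dstar true
  reject : ∀ D : PMF (Fin N), FullSupport D → ε ≤ tvDist D Dstar →
    (2 / 3 : ℝ≥0∞) ≤ A.run D false

end PairCond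

end

namespace PairCond

/-! The hard distribution consists of `r * m` buckets of equal mass, uniform inside, whose sizes
differ pairwise by a factor of at least `K`. The buckets form `r` groups of `m`. An alternative
picks one bucket `J g` in each group, scales its weight by `1 + δ * (m - 1)` and the weights of the
others in the group by `1 - δ`; its distance is `δ * (1 - 1 / m)`.

Pair queries are nearly useless. Inside a bucket the scaling cancels (`condWeight_mul_of_eq`);
across buckets the lighter element is hardly ever returned, under either hypothesis
(`sum_abs_condWeight_sub_le`). Hence `abs_accept_sub_accept_le` answers all pair queries as under
the null hypothesis, at cost `O(q * m ^ 2 / K)`.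

Only samples remain. By `sq_sum_accept_le`, a second moment method that runs along an adaptive tree,
the squared advantage against a random `J` is at most the mean over `J, J'` of the `q`-th power of
the inner product of likelihood ratios, minus 1. By `gram_bucketRatio` this inner product is 1 plus
`δ ^ 2 / r` times a centred coincidence count, and the exponential moment bound
`sum_exp_coincidences_le` keeps the advantage small unless `q` is of order `√r / δ ^ 2`, for fixed
`m`.

In `theorem5`, `m` depends on `ε₀` only and `K` is about `(ε⁻¹ * log N) ^ 2`, so `r` of order `log N
/ log (ε⁻¹ * log N)` is affordable. If `log N` is too small for even one group, the target is of
order `ε⁻²`, and moving mass `ε` onto one point suffices (`exists_lower_bound_of_two_le`).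
`IsIdentityTester.exists_detAlg` reduces randomized testers to single trees. -/

/-- The probability of acceptance of a decision tree whose sampling queries are answered according
to the weights `s` and whose pair-conditional queries are answered according to `k`. -/
noncomputable def accept {N : ℕ} (s : Fin N → ℝ) (k : Fin N → Fin N → Fin N → ℝ) : DetAlg N → ℝ
  | .output b => if b then 1 else 0
  | .samp next => ∑ i, s i * accept s k (next i)
  | .pcond x y next => ∑ i, k x y i * accept s k (next i)

/-- The weights `d` conditioned on `{x, y}`. -/
noncomputable def condWeight {N : ℕ} (d : Fin N → ℝ) (x y i : Fin N) : ℝ :=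
  if i ∈ ({x, y} : Finset (Fin N)) then d i / ∑ j ∈ {x, y}, d j else 0

/-! ### From `PMF` to real weights -/

section weights

variable {N : ℕ}

theorem condWeight_eq_zero (d : Fin N → ℝ) {x y i : Fin N} (hx : i ≠ x) (hy : i ≠ y) :
    condWeight d x y i = 0 := by
  simp [condWeight, hx, hy]

theorem sum_pair_pos {d : Fin N → ℝ} (hd : ∀ i, 0 < d i) (x y : Fin N) :
    0 < ∑ j ∈ ({x, y} : Finset (Fin N)), d j :=
  Finset.sum_pos (fun i _ => hd i) ⟨x, by simp⟩

theorem sum_condWeight_mul (d : Fin N → ℝ) (x y : Fin N) (g : Fin N → ℝ) :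
    ∑ i, condWeight d x y i * g i
      = (∑ i ∈ ({x, y} : Finset (Fin N)), d i * g i) / ∑ j ∈ ({x, y} : Finset (Fin N)), d j := by
  simp only [condWeight, ite_mul, zero_mul, Finset.sum_ite_mem, Finset.univ_inter]
  rw [Finset.sum_div]
  exact Finset.sum_congr rfl fun i _ => by ring

theorem condWeight_mem_stdSimplex {d : Fin N → ℝ} (hd : ∀ i, 0 < d i) (x y : Fin N) :
    condWeight d x y ∈ stdSimplex ℝ (Fin N) := by
  refine ⟨fun i => ?_, ?_⟩
  · unfold condWeight
    split_ifs
    · exact div_nonneg (hd i).le (sum_pair_pos hd x y).le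
    · exact le_rfl
  · have := sum_condWeight_mul d x y fun _ => 1
    simp only [mul_one] at this
    rw [this, div_self (sum_pair_pos hd x y).ne']

theorem toReal_pcond {D : PMF (Fin N)} (hD : FullSupport D) (x y i : Fin N) :
    (pcond D x y i).toReal = condWeight (fun j => (D j).toReal) x y i := by
  classical
  have h : ∃ a ∈ ({x, y} : Set (Fin N)), a ∈ D.support :=
    ⟨x, by simp, (PMF.mem_support_iff _ _).2 (hD x)⟩
  have hsum : ∑' a, ({x, y} : Set (Fin N)).indicator D a
      = ∑ j ∈ ({x, y} : Finset (Fin N)), D j := by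
    rw [tsum_fintype, ← Finset.coe_pair, Finset.sum_indicator_subset _ (Finset.subset_univ _)]
  rw [pcond, dif_pos h, PMF.filter_apply, hsum, ENNReal.toReal_mul, ENNReal.toReal_inv,
    ENNReal.toReal_sum fun j _ => D.apply_ne_top j, condWeight, ← div_eq_mul_inv]
  by_cases hi : i ∈ ({x, y} : Finset (Fin N))
  · rw [if_pos hi, Set.indicator_of_mem (by simpa using hi)]
  · rw [if_neg hi, Set.indicator_of_notMem (by simpa using hi)]
    simp

theorem toReal_run {D : PMF (Fin N)} (hD : FullSupport D) (t : DetAlg N) :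
    (t.run D true).toReal
      = accept (fun i => (D i).toReal) (condWeight fun i => (D i).toReal) t := by
  have key : ∀ (p : PMF (Fin N)) (next : Fin N → DetAlg N),
      (p.bind (fun i => (next i).run D) true).toReal
        = ∑ i, (p i).toReal * ((next i).run D true).toReal := by
    intro p next
    rw [PMF.bind_apply, tsum_fintype, ENNReal.toReal_sum]
    · simp only [ENNReal.toReal_mul]
    · exact fun i _ => ENNReal.mul_ne_top (p.apply_ne_top i) (PMF.apply_ne_top _ _)
  induction t with
  | output b => cases b <;> simp [DetAlg.run, accept]
  | samp next ih =>
    rw [DetAlg.run, accept, key]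
    simp only [ih]
  | pcond x y next ih =>
    rw [DetAlg.run, accept, key]
    simp only [ih, toReal_pcond hD]

/-- The distribution with the given real weights. -/
noncomputable def pmfOfWeights (d : Fin N → ℝ) (hd : d ∈ stdSimplex ℝ (Fin N)) : PMF (Fin N) :=
  PMF.ofFintype (fun i => ENNReal.ofReal (d i)) (by
    rw [← ENNReal.ofReal_sum_of_nonneg fun i _ => hd.1 i, hd.2, ENNReal.ofReal_one])

theorem toReal_pmfOfWeights (d : Fin N → ℝ) (hd : d ∈ stdSimplex ℝ (Fin N)) (i : Fin N) :
    (pmfOfWeights d hd i).toReal = d i := by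
  simp [pmfOfWeights, ENNReal.toReal_ofReal (hd.1 i)]

theorem fullSupport_pmfOfWeights {d : Fin N → ℝ} (hd : d ∈ stdSimplex ℝ (Fin N))
    (hpos : ∀ i, 0 < d i) : FullSupport (pmfOfWeights d hd) := by
  intro i h
  have := toReal_pmfOfWeights d hd i
  rw [h] at this
  exact (hpos i).ne this

theorem tvDist_pmfOfWeights (d e : Fin N → ℝ) (hd : d ∈ stdSimplex ℝ (Fin N))
    (he : e ∈ stdSimplex ℝ (Fin N)) :
    tvDist (pmfOfWeights d hd) (pmfOfWeights e he) = 1 / 2 * ∑ i, |d i - e i| := by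
  simp only [tvDist, toReal_pmfOfWeights]

theorem toReal_run_pmfOfWeights {d : Fin N → ℝ} (hd : d ∈ stdSimplex ℝ (Fin N))
    (hpos : ∀ i, 0 < d i) (t : DetAlg N) :
    (t.run (pmfOfWeights d hd) true).toReal = accept d (condWeight d) t := by
  rw [toReal_run (fullSupport_pmfOfWeights hd hpos)]
  simp only [toReal_pmfOfWeights]

end weights

/-! ### Hybrid argument and second moments along decision trees -/

section accept

variable {N : ℕ} {s : Fin N → ℝ} {k k' : Fin N → Fin N → Fin N → ℝ}

theorem sum_mul_mem_Icc {p v : Fin N → ℝ} (hp : p ∈ stdSimplex ℝ (Fin N))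
    (hv : ∀ i, v i ∈ Set.Icc (0 : ℝ) 1) : ∑ i, p i * v i ∈ Set.Icc (0 : ℝ) 1 := by
  refine ⟨Finset.sum_nonneg fun i _ => mul_nonneg (hp.1 i) (hv i).1, ?_⟩
  rw [← hp.2]
  exact Finset.sum_le_sum fun i _ => mul_le_of_le_one_right (hp.1 i) (hv i).2

theorem accept_mem_Icc (hs : s ∈ stdSimplex ℝ (Fin N)) (hk : ∀ x y, k x y ∈ stdSimplex ℝ (Fin N))
    (t : DetAlg N) : accept s k t ∈ Set.Icc (0 : ℝ) 1 := by
  induction t with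
  | output b => cases b <;> simp [accept]
  | samp next ih => exact sum_mul_mem_Icc hs ih
  | pcond x y next ih => exact sum_mul_mem_Icc (hk x y) ih

theorem queries_le_of_samp {next : Fin N → DetAlg N} {n : ℕ}
    (h : (DetAlg.samp next).queries ≤ n + 1) (i : Fin N) : (next i).queries ≤ n := by
  have := Finset.le_sup (f := fun i => (next i).queries) (Finset.mem_univ i)
  simp only [DetAlg.queries] at h this
  omega

theorem queries_le_of_pcond {next : Fin N → DetAlg N} {n : ℕ} {x y : Fin N}
    (h : (DetAlg.pcond x y next).queries ≤ n + 1) {i : Fin N} (hi : i = x ∨ i = y) :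
    (next i).queries ≤ n := by
  simp only [DetAlg.queries] at h
  rcases hi with rfl | rfl <;> omega

theorem abs_sum_mul_le {p v : Fin N → ℝ} {a : ℝ} (hp : p ∈ stdSimplex ℝ (Fin N))
    (hv : ∀ i, p i ≠ 0 → |v i| ≤ a) : |∑ i, p i * v i| ≤ a := by
  calc |∑ i, p i * v i| ≤ ∑ i, p i * a := by
        refine (Finset.abs_sum_le_sum_abs _ _).trans (Finset.sum_le_sum fun i _ => ?_)
        rw [abs_mul, abs_of_nonneg (hp.1 i)]
        by_cases h : p i = 0
        · simp [h]
        · exact mul_le_mul_of_nonneg_left (hv i h) (hp.1 i)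
    _ = a := by rw [← Finset.sum_mul, hp.2, one_mul]

/-- Replacing the answers to the pair-conditional queries by answers with close distributions
changes the probability of acceptance by little. -/
theorem abs_accept_sub_accept_le (hs : s ∈ stdSimplex ℝ (Fin N))
    (hk : ∀ x y, k x y ∈ stdSimplex ℝ (Fin N)) (hk' : ∀ x y, k' x y ∈ stdSimplex ℝ (Fin N))
    (hsupp : ∀ x y i, i ≠ x → i ≠ y → k' x y i = 0) {η : ℝ}
    (hη : ∀ x y, ∑ i, |k x y i - k' x y i| ≤ η) (t : DetAlg N) (n : ℕ) (hn : t.queries ≤ n) :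
    |accept s k t - accept s k' t| ≤ n * η := by
  induction t generalizing n with
  | output b =>
    simp only [accept, sub_self, abs_zero]
    rcases n.eq_zero_or_pos with rfl | h
    · simp
    have : ∀ _ : Fin N, 0 ≤ η := fun x =>
      (Finset.sum_nonneg fun i _ => abs_nonneg _).trans (hη x x)
    have hN : Nonempty (Fin N) := by
      by_contra hN
      rw [not_nonempty_iff] at hN
      have := hs.2
      simp at this
    exact mul_nonneg n.cast_nonneg (this hN.some)
  | samp next ih =>
    obtain ⟨n, rfl⟩ : ∃ n', n = n' + 1 := ⟨n - 1, by simp only [DetAlg.queries] at hn; omega⟩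
    simp only [accept, ← Finset.sum_sub_distrib, ← mul_sub]
    have hN : Nonempty (Fin N) := by
      by_contra hN
      rw [not_nonempty_iff] at hN
      have := hs.2
      simp at this
    have h0 : 0 ≤ η :=
      (Finset.sum_nonneg fun i _ => abs_nonneg _).trans (hη hN.some hN.some)
    refine (abs_sum_mul_le hs fun i _ => ih i n (queries_le_of_samp hn i)).trans ?_
    push_cast
    nlinarith
  | pcond x y next ih =>
    obtain ⟨n, rfl⟩ : ∃ n', n = n' + 1 := ⟨n - 1, by simp only [DetAlg.queries] at hn; omega⟩
    -- Exchange the current answer first, then the continuations. The second sum is weighted by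
    -- `k'`, which vanishes off `{x, y}`; `queries` controls only those two continuations.
    have hsplit : accept s k (.pcond x y next) - accept s k' (.pcond x y next)
        = (∑ i, (k x y i - k' x y i) * accept s k (next i))
          + ∑ i, k' x y i * (accept s k (next i) - accept s k' (next i)) := by
      simp only [accept, ← Finset.sum_sub_distrib, ← Finset.sum_add_distrib]
      exact Finset.sum_congr rfl fun i _ => by ring
    have h1 : |∑ i, (k x y i - k' x y i) * accept s k (next i)| ≤ η := by
      refine (Finset.abs_sum_le_sum_abs _ _).trans ((Finset.sum_le_sum fun i _ => ?_).trans (hη x y))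
      obtain ⟨h0, h1⟩ := accept_mem_Icc hs hk (next i)
      rw [abs_mul, abs_of_nonneg h0]
      exact mul_le_of_le_one_right (abs_nonneg _) h1
    have h2 : |∑ i, k' x y i * (accept s k (next i) - accept s k' (next i))| ≤ n * η := by
      refine abs_sum_mul_le (hk' x y) fun i hi => ih i n (queries_le_of_pcond hn ?_)
      by_contra! h
      exact hi (hsupp x y i h.1 h.2)
    rw [hsplit]
    push_cast
    linarith [abs_add_le (∑ i, (k x y i - k' x y i) * accept s k (next i))
      (∑ i, k' x y i * (accept s k (next i) - accept s k' (next i)))]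

theorem sq_sum_mul_le {p v : Fin N → ℝ} (hp : p ∈ stdSimplex ℝ (Fin N)) :
    (∑ i, p i * v i) ^ 2 ≤ ∑ i, p i * v i ^ 2 := by
  simpa [smul_eq_mul] using (even_two.convexOn_pow (𝕜 := ℝ)).map_sum_le (t := Finset.univ)
    (w := p) (p := v) (fun i _ => hp.1 i) hp.2 fun i _ => Set.mem_univ _

/-- The second moment method along a decision tree: a potential `Q n w` that dominates the square of
the total weight, and does not decrease on average along a query, dominates the square of every
weighted sum of the acceptance probabilities under the hypotheses `J : Ω`. -/
theorem sq_sum_accept_le {Ω : Type*} [Fintype Ω] (hs : s ∈ stdSimplex ℝ (Fin N))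
    (hk : ∀ x y, k x y ∈ stdSimplex ℝ (Fin N)) (hsupp : ∀ x y i, i ≠ x → i ≠ y → k x y i = 0)
    (f : Ω → Fin N → ℝ) (g : Ω → Fin N → Fin N → Fin N → ℝ) (Q : ℕ → (Ω → ℝ) → ℝ)
    (hQ : ∀ n w, (∑ J, w J) ^ 2 ≤ Q n w)
    (hsamp : ∀ n w, ∑ i, s i * Q n (fun J => w J * f J i) ≤ Q (n + 1) w)
    (hpcond : ∀ n w x y, ∑ i, k x y i * Q n (fun J => w J * g J x y i) ≤ Q (n + 1) w)
    (t : DetAlg N) (n : ℕ) (hn : t.queries ≤ n) (w : Ω → ℝ) :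
    (∑ J, w J * accept (fun i => s i * f J i) (fun x y i => k x y i * g J x y i) t) ^ 2
      ≤ Q n w := by
  induction t generalizing n w with
  | output b =>
    cases b
    · simpa [accept] using (sq_nonneg _).trans (hQ n w)
    · simpa [accept] using hQ n w
  | samp next ih =>
    obtain ⟨n, rfl⟩ : ∃ n', n = n' + 1 := ⟨n - 1, by simp only [DetAlg.queries] at hn; omega⟩
    -- Jensen over the null answer; the likelihood ratio of that answer is absorbed into the weight
    -- of `J`, and induction applies to the new weights.
    refine le_trans (le_trans (le_of_eq ?_) (sq_sum_mul_le (v := fun i => ∑ J, w J * f J i *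
      accept (fun i => s i * f J i) (fun x y i => k x y i * g J x y i) (next i)) hs)) ?_
    · simp only [accept, Finset.mul_sum]
      rw [Finset.sum_comm]
      congr 1
      exact Finset.sum_congr rfl fun i _ => Finset.sum_congr rfl fun J _ => by ring
    · refine le_trans (Finset.sum_le_sum fun i _ => mul_le_mul_of_nonneg_left ?_ (hs.1 i))
        (hsamp n w)
      exact ih i n (queries_le_of_samp hn i) _
  | pcond x y next ih =>
    obtain ⟨n, rfl⟩ : ∃ n', n = n' + 1 := ⟨n - 1, by simp only [DetAlg.queries] at hn; omega⟩
    refine le_trans (le_trans (le_of_eq ?_) (sq_sum_mul_le (v := fun i => ∑ J, w J * g J x y i *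
      accept (fun i => s i * f J i) (fun x y i => k x y i * g J x y i) (next i)) (hk x y))) ?_
    · simp only [accept, Finset.mul_sum]
      rw [Finset.sum_comm]
      congr 1
      exact Finset.sum_congr rfl fun i _ => Finset.sum_congr rfl fun J _ => by ring
    · refine le_trans (Finset.sum_le_sum fun i _ => ?_) (hpcond n w x y)
      by_cases hi : i = x ∨ i = y
      · exact mul_le_mul_of_nonneg_left (ih i n (queries_le_of_pcond hn hi) _) ((hk x y).1 i)
      · push Not at hi
        simp [hsupp x y i hi.1 hi.2]

end accept

/-! ### Reduction to deterministic trees (Yao's principle) -/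

/-- If a tester makes at most `q` queries, then some decision tree with at most `q` queries
separates the tested distribution from the average of any family of distributions that the tester
has to reject. -/
theorem IsIdentityTester.exists_detAlg {N q : ℕ} {A : Alg N} {Dstar : PMF (Fin N)} {ε : ℝ}
    (hA : IsIdentityTester A Dstar ε) (hq : A.MakesAtMost q) {Ω : Type*} [Fintype Ω] [Nonempty Ω]
    (D : Ω → PMF (Fin N)) (hfull : ∀ J, FullSupport (D J)) (htv : ∀ J, ε ≤ tvDist (D J) Dstar) :
    ∃ t : DetAlg N, t.queries ≤ q ∧ 1 / 4 < (t.run Dstar true).toReal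
      - (Fintype.card Ω : ℝ)⁻¹ * ∑ J, (t.run (D J) true).toReal := by
  by_contra! hcon
  have hc0 : (Fintype.card Ω : ℝ≥0∞) ≠ 0 := by simp
  have hct : (Fintype.card Ω : ℝ≥0∞) ≠ ∞ := by simp
  have hrun : ∀ E : PMF (Fin N), A.run E true = ∑' t, A t * t.run E true := fun E =>
    PMF.bind_apply _ _ _
  -- Additive form, free of truncated subtraction. Averaged over `t`, it bounds the acceptance
  -- probability under `Dstar` by `1 / 3 + 1 / 4 < 2 / 3`.
  have htree : ∀ t, A t * t.run Dstar true
      ≤ (∑ J, (Fintype.card Ω : ℝ≥0∞)⁻¹ * (A t * t.run (D J) true)) + A t * (1 / 4) := by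
    intro t
    by_cases ht : A t = 0
    · simp [ht]
    have h1 := hcon t (hq t ((PMF.mem_support_iff _ _).2 ht))
    have h2 : t.run Dstar true
        ≤ (Fintype.card Ω : ℝ≥0∞)⁻¹ * ∑ J, t.run (D J) true + 1 / 4 := by
      have hs : ∑ J, t.run (D J) true ≠ ∞ :=
        ENNReal.sum_ne_top.2 fun J _ => PMF.apply_ne_top _ _
      have hm : (Fintype.card Ω : ℝ≥0∞)⁻¹ * ∑ J, t.run (D J) true ≠ ∞ :=
        ENNReal.mul_ne_top (ENNReal.inv_ne_top.2 hc0) hs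
      rw [← ENNReal.toReal_le_toReal (PMF.apply_ne_top _ _) (by finiteness),
        ENNReal.toReal_add hm (by finiteness), ENNReal.toReal_mul, ENNReal.toReal_inv,
        ENNReal.toReal_natCast, ENNReal.toReal_sum fun J _ => PMF.apply_ne_top _ _]
      norm_num
      norm_num at h1
      linarith
    calc A t * t.run Dstar true
        ≤ A t * ((Fintype.card Ω : ℝ≥0∞)⁻¹ * ∑ J, t.run (D J) true + 1 / 4) := by gcongr
      _ = _ := by
        rw [mul_add, Finset.mul_sum, Finset.mul_sum]
        congr 1
        exact Finset.sum_congr rfl fun J _ => by ring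
  have hrej : ∀ J, A.run (D J) true ≤ 1 / 3 := by
    intro J
    have h1 := hA.reject (D J) (hfull J) (htv J)
    have h2 := (A.run (D J)).tsum_coe
    rw [tsum_fintype, Fintype.sum_bool] at h2
    have h3 : A.run (D J) true + 2 / 3 ≤ 1 / 3 + 2 / 3 := by
      calc A.run (D J) true + 2 / 3 ≤ A.run (D J) true + A.run (D J) false := by gcongr
        _ = 1 / 3 + 2 / 3 := by
          rw [h2, ← ENNReal.add_div]
          norm_num
          rw [ENNReal.div_self] <;> norm_num
    exact (ENNReal.add_le_add_iff_right (by finiteness)).1 h3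
  have hfinal : A.run Dstar true ≤ 1 / 3 + 1 / 4 := by
    calc A.run Dstar true
        ≤ ∑' t, ((∑ J, (Fintype.card Ω : ℝ≥0∞)⁻¹ * (A t * t.run (D J) true)) + A t * (1 / 4)) := by
          rw [hrun]
          exact ENNReal.tsum_le_tsum htree
      _ = (∑ J, (Fintype.card Ω : ℝ≥0∞)⁻¹ * A.run (D J) true) + 1 / 4 := by
          rw [ENNReal.tsum_add, ENNReal.tsum_mul_right, A.tsum_coe, one_mul,
            Summable.tsum_finsetSum fun _ _ => ENNReal.summable]
          simp only [ENNReal.tsum_mul_left, hrun]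
      _ ≤ (∑ _J : Ω, (Fintype.card Ω : ℝ≥0∞)⁻¹ * (1 / 3)) + 1 / 4 := by
          gcongr with J
          exact hrej J
      _ = 1 / 3 + 1 / 4 := by
          rw [Finset.sum_const, Finset.card_univ, nsmul_eq_mul, ← mul_assoc,
            ENNReal.mul_inv_cancel hc0 hct, one_mul]
  have h := hA.accept.trans hfinal
  rw [← ENNReal.toReal_le_toReal (by finiteness) (by finiteness),
    ENNReal.toReal_add (by finiteness) (by finiteness)] at h
  norm_num at h

/-! ### One alternative with bounded likelihood ratios -/

section twoPoint

variable {N : ℕ}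

/-- As `g` has mean 1, its second moment is 1 plus its variance. This is the growth factor of the
potential per query. -/
theorem sum_mul_sq_le_of_abs_sub_one_le {p g : Fin N → ℝ} {b : ℝ} (hp : p ∈ stdSimplex ℝ (Fin N))
    (hg : ∑ i, p i * g i = 1) (hb : ∀ i, p i ≠ 0 → |g i - 1| ≤ b) :
    ∑ i, p i * g i ^ 2 ≤ 1 + b ^ 2 := by
  have h1 : ∑ i, p i * (g i - 1) ^ 2 = ∑ i, p i * g i ^ 2 - 1 := by
    have : ∀ i, p i * (g i - 1) ^ 2 = p i * g i ^ 2 - 2 * (p i * g i) + p i := fun i => by ring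
    simp only [this, Finset.sum_add_distrib, Finset.sum_sub_distrib, ← Finset.mul_sum, hg, hp.2]
    ring
  have h2 : ∑ i, p i * (g i - 1) ^ 2 ≤ b ^ 2 :=
    (le_abs_self _).trans (abs_sum_mul_le hp fun i hi => by
      rw [abs_of_nonneg (sq_nonneg _), ← sq_abs]
      exact pow_le_pow_left₀ (abs_nonneg _) (hb i hi) 2)
  linarith

theorem abs_sub_sum_mul_le {p f : Fin N → ℝ} {b : ℝ} (hp : p ∈ stdSimplex ℝ (Fin N))
    (hf : ∀ i j, |f i - f j| ≤ b) (i : Fin N) : |f i - ∑ j, p j * f j| ≤ b := by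
  have : f i - ∑ j, p j * f j = ∑ j, p j * (f i - f j) := by
    simp only [mul_sub, Finset.sum_sub_distrib, ← Finset.sum_mul, hp.2, one_mul]
  rw [this]
  exact abs_sum_mul_le hp fun j _ => hf i j

theorem le_sum_mul {p f : Fin N → ℝ} {a : ℝ} (hp : p ∈ stdSimplex ℝ (Fin N)) (hf : ∀ i, a ≤ f i) :
    a ≤ ∑ i, p i * f i := by
  calc a = ∑ i, p i * a := by rw [← Finset.sum_mul, hp.2, one_mul]
    _ ≤ _ := Finset.sum_le_sum fun i _ => mul_le_mul_of_nonneg_left (hf i) (hp.1 i)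

/-- Conditioning renormalizes: the likelihood ratio of an answer is `f i` divided by the conditional
mean of `f`. -/
theorem condWeight_mul {d f : Fin N → ℝ} (hd : ∀ i, 0 < d i) (x y i : Fin N) :
    condWeight (fun j => d j * f j) x y i
      = condWeight d x y i * (f i / ∑ j, condWeight d x y j * f j) := by
  rw [sum_condWeight_mul]
  have := (sum_pair_pos hd x y).ne'
  unfold condWeight
  split_ifs
  · rw [div_div_eq_mul_div, div_mul_div_comm, mul_comm (∑ j ∈ {x, y}, d j), ← mul_assoc,
      mul_div_mul_right _ _ this]
  · simp

/-- If all likelihood ratios are close to each other, then the two acceptance probabilities of a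
shallow decision tree are close. -/
theorem sq_accept_sub_accept_le {d f : Fin N → ℝ} (hd : d ∈ stdSimplex ℝ (Fin N))
    (hpos : ∀ i, 0 < d i) (hf1 : ∑ i, d i * f i = 1) {a b : ℝ} (ha : 0 < a) (ha1 : a ≤ 1)
    (haf : ∀ i, a ≤ f i) (hb : ∀ i j, |f i - f j| ≤ b) (t : DetAlg N) (n : ℕ) (hn : t.queries ≤ n) :
    (accept (fun i => d i * f i) (condWeight fun i => d i * f i) t - accept d (condWeight d) t) ^ 2
      ≤ (1 + (b / a) ^ 2) ^ n - 1 := by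
  set B := (b / a) ^ 2 with hB
  have hB0 : 0 ≤ B := sq_nonneg _
  let g : Fin N → Fin N → Fin N → ℝ := fun x y i => f i / ∑ j, condWeight d x y j * f j
  have hc := condWeight_mem_stdSimplex hpos
  have hF : ∀ x y, 0 < ∑ j, condWeight d x y j * f j := fun x y =>
    ha.trans_le (le_sum_mul (hc x y) haf)
  -- Here `true` is the alternative and `false` the null hypothesis. The ratio has mean 1, so the
  -- cross term is preserved; only the square of the weight of `true` gains a factor `1 + B`.
  have hstep : ∀ (p h : Fin N → ℝ), p ∈ stdSimplex ℝ (Fin N) → ∑ i, p i * h i = 1 →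
      (∀ i, |h i - 1| ≤ b / a) → ∀ (n : ℕ) (w : Bool → ℝ),
      ∑ i, p i * ((w true * h i) ^ 2 * (1 + B) ^ n + 2 * (w true * h i) * w false + w false ^ 2)
        ≤ w true ^ 2 * (1 + B) ^ (n + 1) + 2 * w true * w false + w false ^ 2 := by
    intro p h hp h1 hh n w
    have h2 := sum_mul_sq_le_of_abs_sub_one_le hp h1 fun i _ => hh i
    have : ∀ i, p i * ((w true * h i) ^ 2 * (1 + B) ^ n + 2 * (w true * h i) * w false
        + w false ^ 2) = w true ^ 2 * (1 + B) ^ n * (p i * h i ^ 2)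
          + 2 * w true * w false * (p i * h i) + w false ^ 2 * p i := fun i => by ring
    simp only [this, Finset.sum_add_distrib, ← Finset.mul_sum, h1, hp.2, mul_one]
    have : w true ^ 2 * (1 + B) ^ n * ∑ i, p i * h i ^ 2 ≤ w true ^ 2 * (1 + B) ^ n * (1 + B) :=
      mul_le_mul_of_nonneg_left h2 (by positivity)
    rw [pow_succ (1 + B), ← mul_assoc]
    linarith
  have hb0 : ∀ _ : Fin N, 0 ≤ b := fun i => (abs_nonneg _).trans (hb i i)
  have key := sq_sum_accept_le hd hc (fun x y i => condWeight_eq_zero d)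
    (fun J i => if J then f i else 1) (fun J x y i => if J then g x y i else 1)
    (fun n w => w true ^ 2 * (1 + B) ^ n + 2 * w true * w false + w false ^ 2)
    (fun n w => by
      have : 1 ≤ (1 + B) ^ n := one_le_pow₀ (by linarith)
      rw [Fintype.sum_bool]
      nlinarith [sq_nonneg (w true)])
    (fun n w => by
      simpa using hstep d f hd hf1 (fun i => by
        have h := abs_sub_sum_mul_le hd hb i
        rw [hf1] at h
        refine h.trans ?_
        rw [le_div_iff₀ ha]
        exact mul_le_of_le_one_right (hb0 i) ha1) n w)
    (fun n w x y => by
      simpa using hstep (condWeight d x y) (g x y) (hc x y) (by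
        simp only [g, mul_div_assoc', ← Finset.sum_div]
        exact div_self (hF x y).ne') (fun i => by
          simp only [g]
          rw [div_sub_one (hF x y).ne', abs_div, abs_of_pos (hF x y)]
          exact div_le_div₀ (hb0 i) (abs_sub_sum_mul_le (hc x y) hb i) ha
            (le_sum_mul (hc x y) haf)) n w)
    t n hn (fun J => if J then 1 else -1)
  have hcw : (condWeight fun j => d j * f j) = fun x y i => condWeight d x y i * g x y i := by
    funext x y i
    exact condWeight_mul hpos x y i
  simp only [Fintype.sum_bool, if_true, Bool.false_eq_true, if_false, mul_one, one_mul] at key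
  rw [hcw]
  have e : ∀ u v : ℝ, u + -1 * v = u - v := fun u v => by ring
  rw [e] at key
  linarith

/-- A tester needs on the order of `ε⁻²` queries if the tested distribution is uniform apart from
one point. -/
theorem exists_lower_bound_of_two_le (hN : 2 ≤ N) {p ε : ℝ} (hp : 0 < p) (hε : 0 < ε)
    (hεp : ε ≤ 1 - 2 * p) :
    ∃ Dstar : PMF (Fin N), FullSupport Dstar ∧ ∀ (A : Alg N) (q : ℕ),
      IsIdentityTester A Dstar ε → A.MakesAtMost q → p ^ 4 / 128 < q * ε ^ 2 := by
  obtain ⟨n, rfl⟩ : ∃ n, N = n + 2 := ⟨N - 2, by omega⟩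
  have hn : (0 : ℝ) < n + 1 := by positivity
  have hp1 : 0 < 1 - p := by linarith
  -- The alternative moves mass `ε` from the other points, proportionally, to the first one.
  let d : Fin (n + 2) → ℝ := Fin.cons p fun _ => (1 - p) / (n + 1)
  let f : Fin (n + 2) → ℝ := Fin.cons (1 + ε / p) fun _ => 1 - ε / (1 - p)
  -- Amounts to `ε ≤ (1 - p) ^ 2`, which follows from `ε ≤ 1 - 2 * p`.
  have hfl : p ≤ 1 - ε / (1 - p) := by
    have : ε / (1 - p) ≤ 1 - p := by rw [div_le_iff₀ hp1]; nlinarith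
    linarith
  have hdpos : ∀ i, 0 < d i := by
    intro i
    refine Fin.cases ?_ (fun j => ?_) i
    · simpa [d] using hp
    · simp only [d, Fin.cons_succ]; positivity
  have hf : ∀ i, p ≤ f i := by
    intro i
    refine Fin.cases ?_ (fun j => ?_) i
    · simp only [f, Fin.cons_zero]
      have : 0 < ε / p := by positivity
      linarith
    · simpa only [f, Fin.cons_succ] using hfl
  have hd : d ∈ stdSimplex ℝ (Fin (n + 2)) := by
    refine ⟨fun i => (hdpos i).le, ?_⟩
    rw [Fin.sum_univ_succ]
    simp [d]
    field_simp
    ring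
  have hdf : ∑ i, d i * f i = 1 := by
    rw [Fin.sum_univ_succ]
    simp [d, f]
    field_simp
    ring
  have hdfpos : ∀ i, 0 < d i * f i := fun i => mul_pos (hdpos i) (hp.trans_le (hf i))
  have he : (fun i => d i * f i) ∈ stdSimplex ℝ (Fin (n + 2)) := ⟨fun i => (hdfpos i).le, hdf⟩
  have hdiff : ∀ i j, |f i - f j| ≤ 2 * ε / p := by
    have h1 : ε / (1 - p) ≤ ε / p := div_le_div_of_nonneg_left hε.le hp (by linarith)
    have h2 : 0 < ε / (1 - p) := by positivity
    have h3 : 2 * ε / p = ε / p + ε / p := by ring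
    intro i j
    rw [h3]
    refine Fin.cases ?_ (fun i => ?_) i <;> refine Fin.cases ?_ (fun j => ?_) j <;>
      simp only [f, Fin.cons_zero, Fin.cons_succ] <;> rw [abs_le] <;> constructor <;> linarith
  refine ⟨pmfOfWeights d hd, fullSupport_pmfOfWeights hd hdpos, fun A q hA hq => ?_⟩
  by_contra! hcon
  obtain ⟨t, htq, ht⟩ := hA.exists_detAlg hq (fun _ : Unit => pmfOfWeights _ he)
    (fun _ => fullSupport_pmfOfWeights he hdfpos) (fun _ => by
      rw [tvDist_pmfOfWeights, Fin.sum_univ_succ]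
      have h1 : p * (1 + ε / p) - p = ε := by field_simp; ring
      have h2 : (1 - p) / (n + 1) * (1 - ε / (1 - p)) - (1 - p) / (n + 1) = -(ε / (n + 1)) := by
        field_simp; ring
      simp only [d, f, Fin.cons_zero, Fin.cons_succ, h1, h2, abs_neg, abs_of_pos hε,
        abs_of_pos (div_pos hε hn), Finset.sum_const, Finset.card_univ, Fintype.card_fin,
        nsmul_eq_mul]
      push_cast
      rw [mul_div_cancel₀ _ hn.ne']
      linarith)
  rw [toReal_run_pmfOfWeights hd hdpos] at ht
  simp only [toReal_run_pmfOfWeights he hdfpos, Fintype.card_unit, Nat.cast_one, inv_one,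
    Finset.univ_unique, Finset.sum_singleton, one_mul] at ht
  have h := sq_accept_sub_accept_le hd hdpos hdf hp (by linarith) hf hdiff t q htq
  -- The constant 128 makes the exponent at most `4 / 128 = 1 / 32`; the squared advantage is then
  -- at most `1 / 16`.
  have hexp : (1 + (2 * ε / p / p) ^ 2) ^ q ≤ 1 + 1 / 16 := by
    calc (1 + (2 * ε / p / p) ^ 2) ^ q ≤ Real.exp ((2 * ε / p / p) ^ 2) ^ q := by
          refine pow_le_pow_left₀ (by positivity) ?_ _
          linarith [Real.add_one_le_exp ((2 * ε / p / p) ^ 2)]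
      _ = Real.exp (q * ε ^ 2 * (4 / p ^ 4)) := by
          rw [← Real.exp_nat_mul]
          congr 1
          field_simp
          ring
      _ ≤ Real.exp (1 / 32) := by
          refine Real.exp_le_exp.2 ?_
          rw [mul_div_assoc', div_le_iff₀ (by positivity)]
          linarith
      _ ≤ 1 + 1 / 16 := by
          have := Real.abs_exp_sub_one_sub_id_le (x := 1 / 32) (by norm_num [abs_of_pos])
          have := (abs_le.1 this).2
          norm_num at this ⊢
          linarith
  nlinarith

end twoPoint

/-! ### Second moments for mixtures of alternatives -/

section gram

variable {N : ℕ} {Ω : Type*} [Fintype Ω]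

/-- The inner product of two likelihood ratios. -/
noncomputable def gram (s : Fin N → ℝ) (f : Ω → Fin N → ℝ) (J J' : Ω) : ℝ :=
  ∑ i, s i * (f J i * f J' i)

/-- The second moment of the weighted sum of the likelihood ratios of `n` samples. -/
noncomputable def gramPotential (s : Fin N → ℝ) (f : Ω → Fin N → ℝ) (n : ℕ) (w : Ω → ℝ) : ℝ :=
  ∑ J, ∑ J', w J * w J' * gram s f J J' ^ n

/-- Averaging `f J i * f J' i` over a null sample contributes exactly one more factor `gram s f J
J'`. -/
theorem sum_mul_gramPotential (s : Fin N → ℝ) (f : Ω → Fin N → ℝ) (n : ℕ) (w : Ω → ℝ) :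
    ∑ i, s i * gramPotential s f n (fun J => w J * f J i) = gramPotential s f (n + 1) w := by
  simp only [gramPotential, Finset.mul_sum]
  rw [Finset.sum_comm]
  refine Finset.sum_congr rfl fun J _ => ?_
  rw [Finset.sum_comm]
  refine Finset.sum_congr rfl fun J' _ => ?_
  rw [pow_succ]
  nth_rw 3 [gram]
  rw [Finset.mul_sum, Finset.mul_sum]
  exact Finset.sum_congr rfl fun i _ => by ring

theorem sq_sum_le_gramPotential {s : Fin N → ℝ} (hs : s ∈ stdSimplex ℝ (Fin N))
    {f : Ω → Fin N → ℝ} (hf : ∀ J, ∑ i, s i * f J i = 1) (n : ℕ) (w : Ω → ℝ) :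
    (∑ J, w J) ^ 2 ≤ gramPotential s f n w := by
  induction n generalizing w with
  | zero =>
    simp only [gramPotential, pow_zero, mul_one, ← Finset.mul_sum, ← Finset.sum_mul]
    rw [sq]
  | succ n ih =>
    rw [← sum_mul_gramPotential]
    refine le_trans (le_trans (le_of_eq ?_) (sq_sum_mul_le (v := fun i => ∑ J, w J * f J i) hs))
      (Finset.sum_le_sum fun i _ => mul_le_mul_of_nonneg_left (ih _) (hs.1 i))
    simp only [Finset.mul_sum]
    rw [Finset.sum_comm]
    congr 1
    refine Finset.sum_congr rfl fun J _ => ?_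
    calc w J = w J * ∑ i, s i * f J i := by rw [hf, mul_one]
      _ = _ := by
        rw [Finset.mul_sum]
        exact Finset.sum_congr rfl fun i _ => by ring

/-- Pays for a pair query that reveals nothing. The case `n = 0` is Jensen's inequality; the
averaging identity for samples propagates it. -/
theorem gramPotential_le_succ {s : Fin N → ℝ} (hs : s ∈ stdSimplex ℝ (Fin N))
    {f : Ω → Fin N → ℝ} (hf : ∀ J, ∑ i, s i * f J i = 1) (n : ℕ) (w : Ω → ℝ) :
    gramPotential s f n w ≤ gramPotential s f (n + 1) w := by
  induction n generalizing w with
  | zero =>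
    refine le_trans (le_of_eq ?_) (sq_sum_le_gramPotential hs hf 1 w)
    simp only [gramPotential, pow_zero, mul_one, ← Finset.mul_sum, ← Finset.sum_mul]
    rw [sq]
  | succ n ih =>
    rw [← sum_mul_gramPotential s f n, ← sum_mul_gramPotential s f (n + 1)]
    exact Finset.sum_le_sum fun i _ => mul_le_mul_of_nonneg_left (ih _) (hs.1 i)

/-- If the pair-conditional queries have the same answers under all hypotheses, then the average
acceptance probability differs little from that under the null hypothesis. -/
theorem sq_average_accept_sub_accept_le [Nonempty Ω] {s : Fin N → ℝ}
    {k : Fin N → Fin N → Fin N → ℝ} (hs : s ∈ stdSimplex ℝ (Fin N))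
    (hk : ∀ x y, k x y ∈ stdSimplex ℝ (Fin N)) (hsupp : ∀ x y i, i ≠ x → i ≠ y → k x y i = 0)
    {f : Ω → Fin N → ℝ} (hf : ∀ J, ∑ i, s i * f J i = 1) (t : DetAlg N) (n : ℕ)
    (hn : t.queries ≤ n) :
    ((Fintype.card Ω : ℝ)⁻¹ * ∑ J, accept (fun i => s i * f J i) k t - accept s k t) ^ 2
      ≤ ((Fintype.card Ω : ℝ)⁻¹) ^ 2 * ∑ J, ∑ J', gram s f J J' ^ n - 1 := by
  set c := (Fintype.card Ω : ℝ)⁻¹ with hc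
  have hcard : (Fintype.card Ω : ℝ) ≠ 0 := by simp
  -- `none` is the null hypothesis, with ratio 1 and weight `-1`. Its inner product with every
  -- hypothesis is 1, so it contributes `1 - 2` to the second moment.
  let f' : Option Ω → Fin N → ℝ := fun J => J.elim (fun _ => 1) f
  have hf' : ∀ J, ∑ i, s i * f' J i = 1 := by
    intro J
    cases J with
    | none => simpa [f'] using hs.2
    | some J => exact hf J
  have key := sq_sum_accept_le hs hk hsupp f' (fun _ _ _ _ => 1) (gramPotential s f')
    (sq_sum_le_gramPotential hs hf') (fun n w => (sum_mul_gramPotential s f' n w).le)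
    (fun n w x y => by
      simp only [mul_one, ← Finset.sum_mul, (hk x y).2, one_mul]
      exact gramPotential_le_succ hs hf' n w) t n hn (fun J => J.elim (-1) fun _ => c)
  have g00 : gram s f' none none = 1 := by simpa [gram, f'] using hs.2
  have g01 : ∀ J, gram s f' none (some J) = 1 := fun J => by simpa [gram, f'] using hf J
  have g10 : ∀ J, gram s f' (some J) none = 1 := fun J => by simpa [gram, f'] using hf J
  have g11 : ∀ J J', gram s f' (some J) (some J') = gram s f J J' := fun J J' => rfl
  have hcc : (Fintype.card Ω : ℝ) * c = 1 := mul_inv_cancel₀ hcard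
  simp only [gramPotential, Fintype.sum_option, Option.elim_none, Option.elim_some, g00, g01, g10,
    g11, one_pow, mul_one, f', Finset.sum_const, Finset.card_univ, nsmul_eq_mul,
    Finset.sum_add_distrib, ← Finset.mul_sum] at key
  have e1 : -1 * accept s k t + c * ∑ J, accept (fun i => s i * f J i) k t
      = c * ∑ J, accept (fun i => s i * f J i) k t - accept s k t := by ring
  rw [e1] at key
  refine key.trans (le_of_eq ?_)
  linear_combination (-2 : ℝ) * hcc

end gram

/-! ### Exponential moments of the coincidence count -/

section exponential

theorem sum_ite_eq_fin {m : ℕ} (a : Fin m) (u v : ℝ) :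
    ∑ j, (if j = a then u else v) = u + (m - 1) * v := by
  have : ∀ j, (if j = a then u else v) = (if j = a then u - v else 0) + v := fun j => by
    split_ifs <;> ring
  simp only [this, Finset.sum_add_distrib, Finset.sum_ite_eq', Finset.mem_univ, if_true,
    Finset.sum_const, Finset.card_univ, Fintype.card_fin, nsmul_eq_mul]
  ring

/-- Use `exp x ≤ 1 + x + x ^ 2` for `|x| ≤ 1`: the linear terms cancel, and the squares add up to `l
^ 2 * m * (m - 1)`. -/
theorem sum_exp_ite_le {m : ℕ} (hm : 1 ≤ m) (a : Fin m) {l : ℝ} (hl : 0 ≤ l) (hlm : l * m ≤ 1) :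
    ∑ j, Real.exp (l * ((if j = a then (m : ℝ) else 0) - 1)) ≤ m * Real.exp (l ^ 2 * m) := by
  have hm' : (1 : ℝ) ≤ m := by exact_mod_cast hm
  have h1 : ∀ j, Real.exp (l * ((if j = a then (m : ℝ) else 0) - 1))
      ≤ if j = a then 1 + l * (m - 1) + (l * (m - 1)) ^ 2 else 1 - l + l ^ 2 := by
    intro j
    have hx : |l * ((if j = a then (m : ℝ) else 0) - 1)| ≤ 1 := by
      rw [abs_le]
      split_ifs <;> constructor <;> nlinarith
    have := (abs_le.1 (Real.abs_exp_sub_one_sub_id_le hx)).2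
    split_ifs at this ⊢ <;> nlinarith
  refine (Finset.sum_le_sum fun j _ => h1 j).trans ?_
  rw [sum_ite_eq_fin]
  have h2 := Real.add_one_le_exp (l ^ 2 * m)
  nlinarith [sq_nonneg l]

/-- A Hoeffding-type bound for the number of coincidences of a random `J` with a given `J'`. -/
theorem sum_exp_coincidences_le {r m : ℕ} (hm : 1 ≤ m) (J' : Fin r → Fin m) {l : ℝ} (hl : 0 ≤ l)
    (hlm : l * m ≤ 1) :
    ∑ J : Fin r → Fin m, Real.exp (l * ∑ g, ((if J g = J' g then (m : ℝ) else 0) - 1))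
      ≤ (m : ℝ) ^ r * Real.exp (r * (l ^ 2 * m)) := by
  -- Independence of the groups: the sum over all `J` of a product over `g` factorizes.
  have h := Finset.prod_univ_sum (fun _ : Fin r => (Finset.univ : Finset (Fin m)))
    (fun g j => Real.exp (l * ((if j = J' g then (m : ℝ) else 0) - 1)))
  rw [Fintype.piFinset_univ] at h
  simp only [Finset.mul_sum, Real.exp_sum]
  rw [← h]
  refine (Finset.prod_le_prod (fun g _ => Finset.sum_nonneg fun j _ => (Real.exp_pos _).le)
    fun g _ => sum_exp_ite_le hm (J' g) hl hlm).trans (le_of_eq ?_)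
  rw [Finset.prod_const, Finset.card_univ, Fintype.card_fin, mul_pow, ← Real.exp_nat_mul]

end exponential

/-! ### The bucket distribution and its alternatives -/

section buckets

variable {N r m : ℕ}

theorem exists_buckets {K B : ℕ} (hK : 2 ≤ K) (hB : 1 ≤ B) (hN : K ^ B ≤ N) :
    ∃ β : Fin N → Fin B, (∀ v, 0 < (Finset.univ.filter fun i => β i = v).card) ∧
      ∀ v v', v < v' → K * (Finset.univ.filter fun i => β i = v).card
        ≤ (Finset.univ.filter fun i => β i = v').card := by
  -- Bucket `v` is `K ^ v ≤ i + 1 < K ^ (v + 1)`, except that the last one takes all the rest. So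
  -- its size has no upper bound, and none is needed, as it is never the smaller of two.
  let β : Fin N → Fin B := fun i => ⟨min (Nat.log K (i + 1)) (B - 1), by omega⟩
  have hpow : ∀ v : Fin B, K ^ (v.1 + 1) ≤ N := fun v =>
    (Nat.pow_le_pow_right (by omega) v.2).trans hN
  have hlow : ∀ v : Fin B, K ^ (v.1 + 1) - K ^ v.1 ≤ (Finset.univ.filter fun i => β i = v).card := by
    intro v
    have hcard : (Finset.Ico (K ^ v.1) (K ^ (v.1 + 1))).card = K ^ (v.1 + 1) - K ^ v.1 :=
      Nat.card_Ico _ _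
    rw [← hcard]
    refine Finset.card_le_card_of_surjOn (fun i : Fin N => i.1 + 1) ?_
    intro a ha
    simp only [Finset.coe_Ico, Set.mem_Ico] at ha
    have hpos : 0 < K ^ v.1 := Nat.pow_pos (by omega)
    have := hpow v
    refine ⟨⟨a - 1, by omega⟩, ?_, by simp only; omega⟩
    have hlog : Nat.log K a = v := Nat.log_eq_of_pow_le_of_lt_pow ha.1 ha.2
    have ha1 : a - 1 + 1 = a := by omega
    simp only [Finset.coe_filter, Finset.mem_univ, true_and, Set.mem_ofPred_eq, β, Fin.ext_iff, ha1,
      hlog]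
    have := v.2
    omega
  have hup : ∀ v : Fin B, v.1 < B - 1 →
      (Finset.univ.filter fun i => β i = v).card ≤ K ^ (v.1 + 1) - K ^ v.1 := by
    intro v hv
    have hcard : (Finset.Ico (K ^ v.1) (K ^ (v.1 + 1))).card = K ^ (v.1 + 1) - K ^ v.1 :=
      Nat.card_Ico _ _
    rw [← hcard]
    refine Finset.card_le_card_of_injOn (fun i : Fin N => i.1 + 1) ?_ ?_
    · intro i hi
      simp only [Finset.coe_filter, Finset.mem_univ, true_and, Set.mem_ofPred_eq, β,
        Fin.ext_iff] at hi
      have hlog : Nat.log K (i.1 + 1) = v := by omega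
      simp only [Finset.coe_Ico, Set.mem_Ico]
      rw [← hlog]
      exact ⟨Nat.pow_log_le_self K (by omega), Nat.lt_pow_succ_log_self (by omega) _⟩
    · intro i _ j _ hij
      simp only at hij
      exact Fin.ext (by omega)
  have hform : ∀ a : ℕ, K ^ (a + 1) - K ^ a = K ^ a * (K - 1) := fun a => by
    rw [pow_succ, Nat.mul_sub, mul_one]
  refine ⟨β, fun v => lt_of_lt_of_le ?_ (hlow v), fun v v' hvv => ?_⟩
  · rw [hform]
    exact Nat.mul_pos (Nat.pow_pos (by omega)) (by omega)
  · have h1 := hup v (by have := v'.2; have : v.1 < v'.1 := hvv; omega)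
    refine le_trans (Nat.mul_le_mul_left K h1) (le_trans ?_ (hlow v'))
    rw [hform, hform, ← mul_assoc, ← pow_succ']
    exact Nat.mul_le_mul_right _ (Nat.pow_le_pow_right (by omega) hvv)

/-- The number of elements of a bucket. -/
def bucketSize (β : Fin N → Fin r × Fin m) (v : Fin r × Fin m) : ℕ :=
  (Finset.univ.filter fun i => β i = v).card

/-- Only the pairwise size gaps matter, so any bijection may distribute the buckets over the groups.
-/
theorem exists_grouped_buckets {K : ℕ} (hK : 2 ≤ K) (hr : 1 ≤ r) (hm : 1 ≤ m)
    (hN : K ^ (r * m) ≤ N) :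
    ∃ β : Fin N → Fin r × Fin m, (∀ v, 0 < bucketSize β v) ∧
      ∀ v v', v ≠ v' → K * bucketSize β v ≤ bucketSize β v' ∨
        K * bucketSize β v' ≤ bucketSize β v := by
  obtain ⟨β, h1, h2⟩ := exists_buckets hK (Nat.mul_pos hr hm : 1 ≤ r * m) hN
  have h : ∀ v, bucketSize (fun i => finProdFinEquiv.symm (β i)) v
      = (Finset.univ.filter fun i => β i = finProdFinEquiv v).card := fun v => by
    simp only [bucketSize, Equiv.symm_apply_eq]
  refine ⟨fun i => finProdFinEquiv.symm (β i), fun v => ?_, fun v v' hv => ?_⟩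
  · rw [h]
    exact h1 _
  · rw [h, h]
    rcases lt_or_gt_of_ne (finProdFinEquiv.injective.ne hv) with h | h
    · exact Or.inl (h2 _ _ h)
    · exact Or.inr (h2 _ _ h)

/-- The weights under which all buckets have the same mass and are uniform. -/
noncomputable def bucketWeight (β : Fin N → Fin r × Fin m) (i : Fin N) : ℝ :=
  ((r * m : ℝ) * bucketSize β (β i))⁻¹

/-- The likelihood ratio of the hypothesis that in the group `g` the bucket `J g` is heavier. -/
noncomputable def bucketRatio (δ : ℝ) (J : Fin r → Fin m) (v : Fin r × Fin m) : ℝ :=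
  if v.2 = J v.1 then 1 + δ * (m - 1) else 1 - δ

theorem sum_bucketWeight_mul {β : Fin N → Fin r × Fin m} (hβ : ∀ v, 0 < bucketSize β v)
    (h : Fin r × Fin m → ℝ) :
    ∑ i, bucketWeight β i * h (β i) = (r * m : ℝ)⁻¹ * ∑ g, ∑ j, h (g, j) := by
  rw [← Fintype.sum_prod_type h, ← Finset.sum_fiberwise _ β, Finset.mul_sum]
  refine Finset.sum_congr rfl fun v _ => ?_
  have h1 : ∑ i with β i = v, bucketWeight β i * h (β i)
      = ∑ i with β i = v, ((r * m : ℝ) * bucketSize β v)⁻¹ * h v := by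
    refine Finset.sum_congr rfl fun i hi => ?_
    rw [bucketWeight, (Finset.mem_filter.1 hi).2]
  have h2 : (bucketSize β v : ℝ) ≠ 0 := by exact_mod_cast (hβ v).ne'
  rw [h1, Finset.sum_const, nsmul_eq_mul]
  change (bucketSize β v : ℝ) * _ = _
  rw [mul_inv]
  field_simp

theorem bucketWeight_pos (hr : 1 ≤ r) (hm : 1 ≤ m) {β : Fin N → Fin r × Fin m}
    (hβ : ∀ v, 0 < bucketSize β v) (i : Fin N) : 0 < bucketWeight β i := by
  have := hβ (β i)
  unfold bucketWeight
  positivity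

/-- In a group the ratio is the constant `1 - δ` plus a spike `δ * m` at `J g`. -/
theorem sum_bucketRatio_mul (δ : ℝ) (J : Fin r → Fin m) (g : Fin r) (h : Fin m → ℝ) :
    ∑ j, bucketRatio δ J (g, j) * h j = (1 - δ) * ∑ j, h j + δ * m * h (J g) := by
  have : ∀ j, bucketRatio δ J (g, j) * h j = (1 - δ) * h j
      + if j = J g then δ * m * h j else 0 := fun j => by
    unfold bucketRatio
    split_ifs <;> ring
  simp [this, Finset.sum_add_distrib, Finset.mul_sum]

theorem sum_bucketWeight_mul_bucketRatio (hr : 1 ≤ r) (hm : 1 ≤ m) {β : Fin N → Fin r × Fin m}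
    (hβ : ∀ v, 0 < bucketSize β v) (δ : ℝ) (J : Fin r → Fin m) :
    ∑ i, bucketWeight β i * bucketRatio δ J (β i) = 1 := by
  have h := fun g => sum_bucketRatio_mul δ J g fun _ => 1
  simp only [mul_one] at h
  rw [sum_bucketWeight_mul hβ]
  simp only [h, Finset.sum_const, Finset.card_univ, Fintype.card_fin, nsmul_eq_mul, mul_one]
  have : (r : ℝ) ≠ 0 := by positivity
  have : (m : ℝ) ≠ 0 := by positivity
  field_simp
  ring

theorem bucketWeight_mem_stdSimplex (hr : 1 ≤ r) (hm : 1 ≤ m) {β : Fin N → Fin r × Fin m}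
    (hβ : ∀ v, 0 < bucketSize β v) : bucketWeight β ∈ stdSimplex ℝ (Fin N) := by
  refine ⟨fun i => (bucketWeight_pos hr hm hβ i).le, ?_⟩
  have h := sum_bucketWeight_mul_bucketRatio hr hm hβ 0 fun _ => ⟨0, hm⟩
  simpa [bucketRatio] using h

/-- Within a group the deviations from 1 sum to zero, so only their products survive; these depend
just on whether `J g = J' g`. -/
theorem gram_bucketRatio (hr : 1 ≤ r) (hm : 1 ≤ m) {β : Fin N → Fin r × Fin m}
    (hβ : ∀ v, 0 < bucketSize β v) (δ : ℝ) (J J' : Fin r → Fin m) :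
    gram (bucketWeight β) (fun J i => bucketRatio δ J (β i)) J J'
      = 1 + δ ^ 2 / r * ∑ g, ((if J g = J' g then (m : ℝ) else 0) - 1) := by
  have hr' : (r : ℝ) ≠ 0 := by positivity
  have hm' : (m : ℝ) ≠ 0 := by positivity
  have h1 : ∀ g, ∑ j, bucketRatio δ J' (g, j) = m := fun g => by
    have h := sum_bucketRatio_mul δ J' g fun _ => 1
    simp only [mul_one, Finset.sum_const, Finset.card_univ, Fintype.card_fin, nsmul_eq_mul] at h
    rw [h]
    ring
  have h2 : ∀ g, ∑ j, bucketRatio δ J (g, j) * bucketRatio δ J' (g, j)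
      = m + δ ^ 2 * m * ((if J g = J' g then (m : ℝ) else 0) - 1) := by
    intro g
    rw [sum_bucketRatio_mul δ J g fun j => bucketRatio δ J' (g, j), h1, bucketRatio]
    dsimp only
    split_ifs <;> ring
  rw [gram, sum_bucketWeight_mul hβ fun v => bucketRatio δ J v * bucketRatio δ J' v]
  simp only [h2, Finset.sum_add_distrib, Finset.sum_const, Finset.card_univ, Fintype.card_fin,
    nsmul_eq_mul, ← Finset.mul_sum]
  field_simp

theorem sum_abs_bucketWeight_sub (hr : 1 ≤ r) (hm : 1 ≤ m) {β : Fin N → Fin r × Fin m}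
    (hβ : ∀ v, 0 < bucketSize β v) {δ : ℝ} (hδ : 0 ≤ δ) (J : Fin r → Fin m) :
    1 / 2 * ∑ i, |bucketWeight β i * bucketRatio δ J (β i) - bucketWeight β i|
      = δ * (1 - (m : ℝ)⁻¹) := by
  have hr' : (r : ℝ) ≠ 0 := by positivity
  have hm' : (1 : ℝ) ≤ m := by exact_mod_cast hm
  have hm0 : (m : ℝ) ≠ 0 := by positivity
  have h1 : ∀ i, |bucketWeight β i * bucketRatio δ J (β i) - bucketWeight β i|
      = bucketWeight β i * |bucketRatio δ J (β i) - 1| := fun i => by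
    rw [← mul_sub_one, abs_mul, abs_of_pos (bucketWeight_pos hr hm hβ i)]
  have h2 : ∀ g j, |bucketRatio δ J (g, j) - 1| = if j = J g then δ * (m - 1) else δ := by
    intro g j
    unfold bucketRatio
    dsimp only
    split_ifs
    · rw [add_sub_cancel_left, abs_of_nonneg (mul_nonneg hδ (by linarith))]
    · rw [sub_sub_cancel_left, abs_neg, abs_of_nonneg hδ]
  simp only [h1]
  rw [sum_bucketWeight_mul hβ fun v => |bucketRatio δ J v - 1|]
  simp only [h2, sum_ite_eq_fin, Finset.sum_const, Finset.card_univ, Fintype.card_fin,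
    nsmul_eq_mul]
  field_simp
  ring

theorem condWeight_comm (d : Fin N → ℝ) (x y : Fin N) : condWeight d x y = condWeight d y x := by
  funext i
  simp only [condWeight, Finset.pair_comm]

/-- If one of two elements is much heavier than the other, a bounded perturbation of the weights
hardly changes the distribution conditioned on the pair. -/
theorem sum_abs_condWeight_sub_le {d f : Fin N → ℝ} (hd : ∀ i, 0 < d i) {m K : ℝ} (hm : 1 ≤ m)
    (hK : 0 < K) (hf : ∀ i, m⁻¹ ≤ f i) (hfm : ∀ i, f i ≤ m) {x y : Fin N} (hxy : x ≠ y)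
    (h : K * d y ≤ d x) :
    ∑ i, |condWeight (fun j => d j * f j) x y i - condWeight d x y i| ≤ 2 * (m ^ 2 / K) := by
  have hm0 : 0 < m := by linarith
  have hf0 : ∀ i, 0 < f i := fun i => lt_of_lt_of_le (by positivity) (hf i)
  have hdx := hd x
  have hdy := hd y
  have hfx := hf0 x
  have hfy := hf0 y
  have hval : ∀ e : Fin N → ℝ, condWeight e x y y = e y / (e x + e y) := fun e => by
    simp [condWeight, Finset.sum_pair hxy]
  have hval' : ∀ e : Fin N → ℝ, condWeight e x y x = e x / (e x + e y) := fun e => by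
    simp [condWeight, Finset.sum_pair hxy]
  have hsum : ∑ i, |condWeight (fun j => d j * f j) x y i - condWeight d x y i|
      = ∑ i ∈ ({x, y} : Finset (Fin N)),
        |condWeight (fun j => d j * f j) x y i - condWeight d x y i| := by
    refine (Finset.sum_subset (Finset.subset_univ _) fun i _ hi => ?_).symm
    simp only [condWeight, if_neg hi, sub_self, abs_zero]
  have h1 : d y * f y / (d x * f x + d y * f y) ≤ m ^ 2 / K := by
    rw [div_le_div_iff₀ (by positivity) hK]
    have h2 : 1 ≤ m * f x := by
      have := mul_le_mul_of_nonneg_left (hf x) hm0.le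
      rwa [mul_inv_cancel₀ hm0.ne'] at this
    calc d y * f y * K = (K * d y) * f y := by ring
      _ ≤ d x * m := mul_le_mul h (hfm y) hfy.le hdx.le
      _ ≤ d x * m * (m * f x) := le_mul_of_one_le_right (by positivity) h2
      _ = m ^ 2 * (d x * f x) := by ring
      _ ≤ _ := by
        have : 0 ≤ m ^ 2 * (d y * f y) := by positivity
        linarith
  have h2 : d y / (d x + d y) ≤ m ^ 2 / K := by
    rw [div_le_div_iff₀ (by positivity) hK]
    have : 1 ≤ m ^ 2 := one_le_pow₀ hm
    nlinarith
  have h3 : 0 ≤ d y * f y / (d x * f x + d y * f y) := by positivity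
  have h4 : 0 ≤ d y / (d x + d y) := by positivity
  have h5 : d x * f x / (d x * f x + d y * f y) = 1 - d y * f y / (d x * f x + d y * f y) := by
    field_simp
    ring
  have h6 : d x / (d x + d y) = 1 - d y / (d x + d y) := by
    field_simp
    ring
  -- Both probabilities of the lighter element `y` lie in `[0, m ^ 2 / K]`. The answer `x` has the
  -- complementary probability, whence the factor 2.
  have h7 : |d y * f y / (d x * f x + d y * f y) - d y / (d x + d y)| ≤ m ^ 2 / K := by
    rw [abs_le]
    constructor <;> linarith
  rw [hsum, Finset.sum_pair hxy, hval, hval, hval', hval']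
  rw [h5, h6, sub_sub_sub_cancel_left, abs_sub_comm (d y / (d x + d y))]
  linarith

/-- A common factor cancels; this handles pairs inside one bucket. -/
theorem condWeight_mul_of_eq {d f : Fin N → ℝ} {x y : Fin N} (hf : f x ≠ 0) (h : f x = f y) :
    condWeight (fun j => d j * f j) x y = condWeight d x y := by
  funext i
  have hconst : ∀ j ∈ ({x, y} : Finset (Fin N)), d j * f j = d j * f x := by
    intro j hj
    rcases Finset.mem_insert.1 hj with rfl | hj
    · rfl
    · rw [Finset.mem_singleton.1 hj, h]
  unfold condWeight
  split_ifs with hi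
  · rw [Finset.sum_congr rfl hconst, ← Finset.sum_mul]
    exact (congrArg (· / _) (hconst i hi)).trans (mul_div_mul_right _ _ hf)
  · rfl

/-- A tester for a distribution with `r` groups of `m` buckets needs on the order of `√r / δ ^ 2`
queries, if the ratio `K` of the bucket sizes makes pair-conditional queries useless. -/
theorem exists_lower_bound_of_pow_le {K : ℕ} (hK : 2 ≤ K) (hr : 1 ≤ r) (hm : 1 ≤ m)
    (hN : K ^ (r * m) ≤ N) {δ : ℝ} (hδ : 0 ≤ δ) (hδm : δ ≤ 1 - (m : ℝ)⁻¹) :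
    ∃ Dstar : PMF (Fin N), FullSupport Dstar ∧ ∀ (A : Alg N) (q : ℕ),
      IsIdentityTester A Dstar (δ * (1 - (m : ℝ)⁻¹)) → A.MakesAtMost q →
        q * (16 * m ^ 2) ≤ (K : ℝ) → (r : ℝ) / 100 < (q * δ ^ 2 * m) ^ 2 := by
  obtain ⟨β, hβ, hsep⟩ := exists_grouped_buckets hK hr hm hN
  have hr0 : (1 : ℝ) ≤ r := by exact_mod_cast hr
  have hm0 : (1 : ℝ) ≤ m := by exact_mod_cast hm
  have hK0 : (0 : ℝ) < K := by positivity
  have hmpos : (0 : ℝ) < (m : ℝ)⁻¹ := by positivity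
  set d := bucketWeight β with hd_def
  set f : (Fin r → Fin m) → Fin N → ℝ := fun J i => bucketRatio δ J (β i) with hf_def
  have hdpos : ∀ i, 0 < d i := bucketWeight_pos hr hm hβ
  have hd : d ∈ stdSimplex ℝ (Fin N) := bucketWeight_mem_stdSimplex hr hm hβ
  have hf1 : ∀ J, ∑ i, d i * f J i = 1 := sum_bucketWeight_mul_bucketRatio hr hm hβ δ
  have hfl : ∀ J i, (m : ℝ)⁻¹ ≤ f J i := by
    intro J i
    simp only [hf_def, bucketRatio]
    have : 0 ≤ δ * (m - 1) := mul_nonneg hδ (by linarith)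
    split_ifs <;> linarith
  have hfu : ∀ J i, f J i ≤ m := by
    intro J i
    simp only [hf_def, bucketRatio]
    split_ifs <;> nlinarith
  have hdf : ∀ J i, 0 < d i * f J i := fun J i => mul_pos (hdpos i) (hmpos.trans_le (hfl J i))
  have he : ∀ J, (fun i => d i * f J i) ∈ stdSimplex ℝ (Fin N) := fun J =>
    ⟨fun i => (hdf J i).le, hf1 J⟩
  have hclose : ∀ J x y, ∑ i, |condWeight (fun j => d j * f J j) x y i - condWeight d x y i|
      ≤ 2 * ((m : ℝ) ^ 2 / K) := by
    intro J x y
    by_cases hxy : β x = β y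
    · rw [condWeight_mul_of_eq (hmpos.trans_le (hfl J x)).ne' (by simp only [hf_def, hxy])]
      simp only [sub_self, abs_zero, Finset.sum_const_zero]
      positivity
    have hne : x ≠ y := fun h => hxy (by rw [h])
    have hheavy : ∀ x y, K * bucketSize β (β x) ≤ bucketSize β (β y) → K * d y ≤ d x := by
      intro x y h
      have h' : (K : ℝ) * bucketSize β (β x) ≤ bucketSize β (β y) := by exact_mod_cast h
      have hx : (0 : ℝ) < bucketSize β (β x) := by exact_mod_cast hβ (β x)
      have hy : (0 : ℝ) < bucketSize β (β y) := by exact_mod_cast hβ (β y)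
      simp only [hd_def, bucketWeight]
      rw [← div_eq_mul_inv, ← one_div, div_le_div_iff₀ (by positivity) (by positivity)]
      have : (0 : ℝ) ≤ r * m := by positivity
      nlinarith
    rcases hsep _ _ hxy with h | h
    · exact sum_abs_condWeight_sub_le hdpos hm0 hK0 (hfl J) (hfu J) hne (hheavy x y h)
    · rw [condWeight_comm _ x y, condWeight_comm d x y]
      exact sum_abs_condWeight_sub_le hdpos hm0 hK0 (hfl J) (hfu J) hne.symm (hheavy y x h)
  have hc := condWeight_mem_stdSimplex hdpos
  have hsupp : ∀ x y i, i ≠ x → i ≠ y → condWeight d x y i = 0 := fun x y i =>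
    condWeight_eq_zero d
  refine ⟨pmfOfWeights d hd, fullSupport_pmfOfWeights hd hdpos, fun A q hA hq hqK => ?_⟩
  by_contra! hcon
  have : Nonempty (Fin r → Fin m) := ⟨fun _ => ⟨0, hm⟩⟩
  obtain ⟨t, htq, ht⟩ := hA.exists_detAlg hq (fun J => pmfOfWeights _ (he J))
    (fun J => fullSupport_pmfOfWeights (he J) (hdf J)) (fun J => by
      rw [tvDist_pmfOfWeights]
      exact (sum_abs_bucketWeight_sub hr hm hβ hδ J).ge)
  rw [toReal_run_pmfOfWeights hd hdpos] at ht
  simp only [fun J => toReal_run_pmfOfWeights (he J) (hdf J)] at ht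
  have hsecond := sq_average_accept_sub_accept_le hd hc hsupp hf1 t q htq
  have hhybrid : ∀ J, accept (fun i => d i * f J i) (condWeight d) t - 1 / 8
      ≤ accept (fun i => d i * f J i) (condWeight fun i => d i * f J i) t := by
    intro J
    have h := abs_accept_sub_accept_le (he J) (condWeight_mem_stdSimplex (hdf J)) hc hsupp
      (hclose J) t q htq
    -- The advantage `1 / 4` is split evenly: `1 / 8` for replacing the pair answers, `1 / 8` for
    -- the second moment bound.
    have h2 : q * (2 * ((m : ℝ) ^ 2 / K)) ≤ 1 / 8 := by
      rw [← mul_div_assoc, ← mul_div_assoc, div_le_iff₀ hK0]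
      linarith
    linarith [(abs_le.1 h).1]
  set c := (Fintype.card (Fin r → Fin m) : ℝ)⁻¹ with hc_def
  have hcard : (Fintype.card (Fin r → Fin m) : ℝ) = (m : ℝ) ^ r := by simp
  have hcpos : 0 < c := by rw [hc_def, hcard]; positivity
  have hcc : c * (m : ℝ) ^ r = 1 := by
    rw [hc_def, hcard]
    exact inv_mul_cancel₀ (by positivity)
  have havg : c * ∑ J, accept (fun i => d i * f J i) (condWeight d) t - 1 / 8
      ≤ c * ∑ J, accept (fun i => d i * f J i) (condWeight fun i => d i * f J i) t := by
    have h := mul_le_mul_of_nonneg_left (Finset.sum_le_sum fun J (_ : J ∈ Finset.univ) =>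
      hhybrid J) hcpos.le
    rw [Finset.sum_sub_distrib, Finset.sum_const, Finset.card_univ, nsmul_eq_mul, hcard,
      mul_sub, ← mul_assoc, hcc, one_mul] at h
    exact h
  -- The coefficient of the coincidence count after bounding `(1 + x) ^ q` by `exp (q * x)`.
  set l : ℝ := q * (δ ^ 2 / r) with hl_def
  have hl : 0 ≤ l := by positivity
  have hlr : (l * m) ^ 2 * r ≤ 1 / 100 := by
    have : (l * m) ^ 2 * r = (q * δ ^ 2 * m) ^ 2 / r := by
      rw [hl_def]
      field_simp
    rw [this, div_le_iff₀ (by positivity)]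
    linarith
  have hlm : l * m ≤ 1 := by
    have : (l * m) ^ 2 ≤ 1 := by nlinarith [sq_nonneg (l * m)]
    exact (abs_le_one_iff_mul_self_le_one.2 (by rwa [sq] at this) |> abs_le.1).2
  have hgram : ∀ J J', gram d f J J' ^ q
      ≤ Real.exp (l * ∑ g, ((if J g = J' g then (m : ℝ) else 0) - 1)) := by
    intro J J'
    have h0 : 0 ≤ gram d f J J' := Finset.sum_nonneg fun i _ => mul_nonneg (hdpos i).le
      (mul_nonneg (hmpos.le.trans (hfl J i)) (hmpos.le.trans (hfl J' i)))
    have h1 : gram d f J J' ≤ Real.exp (δ ^ 2 / r *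
        ∑ g, ((if J g = J' g then (m : ℝ) else 0) - 1)) := by
      rw [gram_bucketRatio hr hm hβ, add_comm]
      exact Real.add_one_le_exp _
    refine (pow_le_pow_left₀ h0 h1 q).trans (le_of_eq ?_)
    rw [← Real.exp_nat_mul, ← mul_assoc]
  have htotal : c ^ 2 * ∑ J, ∑ J', gram d f J J' ^ q ≤ 1 + 1 / 64 := by
    have h1 : ∑ J, ∑ J', gram d f J J' ^ q ≤ (m : ℝ) ^ r * ((m : ℝ) ^ r * Real.exp (1 / 100)) := by
      rw [Finset.sum_comm]
      calc ∑ J', ∑ J, gram d f J J' ^ q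
          ≤ ∑ _J' : Fin r → Fin m, (m : ℝ) ^ r * Real.exp (1 / 100) := by
            refine Finset.sum_le_sum fun J' _ => ?_
            refine (Finset.sum_le_sum fun J _ => hgram J J').trans
              ((sum_exp_coincidences_le hm J' hl hlm).trans ?_)
            refine mul_le_mul_of_nonneg_left (Real.exp_le_exp.2 ?_) (by positivity)
            refine le_trans ?_ hlr
            have : l ^ 2 * m ≤ (l * m) ^ 2 :=
              calc l ^ 2 * m ≤ l ^ 2 * (m * m) :=
                    mul_le_mul_of_nonneg_left (le_mul_of_one_le_left (by positivity) hm0)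
                      (sq_nonneg l)
                _ = (l * m) ^ 2 := by ring
            rw [mul_comm]
            exact mul_le_mul_of_nonneg_right this (by positivity)
        _ = _ := by rw [Finset.sum_const, Finset.card_univ, nsmul_eq_mul, hcard]
    have h2 : Real.exp (1 / 100) ≤ 1 + 1 / 64 := by
      have := Real.abs_exp_sub_one_sub_id_le (x := 1 / 100) (by norm_num [abs_of_pos])
      have := (abs_le.1 this).2
      norm_num at this ⊢
      linarith
    calc c ^ 2 * ∑ J, ∑ J', gram d f J J' ^ q
        ≤ c ^ 2 * ((m : ℝ) ^ r * ((m : ℝ) ^ r * Real.exp (1 / 100))) :=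
          mul_le_mul_of_nonneg_left h1 (sq_nonneg c)
      _ = (c * (m : ℝ) ^ r) ^ 2 * Real.exp (1 / 100) := by ring
      _ ≤ _ := by rw [hcc]; linarith
  have hsq : (c * ∑ J, accept (fun i => d i * f J i) (condWeight d) t
      - accept d (condWeight d) t) ^ 2 ≤ (1 / 8) ^ 2 := by
    refine hsecond.trans ?_
    linarith
  have := (abs_le.1 (abs_le_of_sq_le_sq hsq (by norm_num))).1
  linarith

end buckets

end PairCond

/-! ### Choice of parameters and conclusion -/

/-- If `L = log N` is large enough, there are a bucket ratio `K`, at least of order `ρ`, and a number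
`r` of groups, at least of order `L / T`, such that `r * m` buckets fit into `N` elements. -/
theorem exists_bucket_parameters {m N : ℕ} {C L T ρ : ℝ} (hm : 1 ≤ m) (hL : L = Real.log N)
    (hN : 1 ≤ N) (hρ : 1 ≤ ρ)
    (hC : Real.log (17 * m ^ 2 * ρ) ≤ C * T)
    (hlarge : m * (C * T) ≤ L) :
    ∃ K r : ℕ, 2 ≤ K ∧ 1 ≤ r ∧ K ^ (r * m) ≤ N ∧ 16 * m ^ 2 * ρ ≤ K ∧
      L ≤ 2 * m * C * T * r := by
  have hm0 : (1 : ℝ) ≤ m := by exact_mod_cast hm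
  have hmρ : 1 ≤ (m : ℝ) ^ 2 * ρ := one_le_mul_of_one_le_of_one_le (one_le_pow₀ hm0) hρ
  -- Rounding up costs at most `m ^ 2 * ρ ≥ 1`, hence the 17 in the hypothesis on `C`.
  set K := ⌈16 * (m : ℝ) ^ 2 * ρ⌉₊ with hK
  have hK1 : 16 * (m : ℝ) ^ 2 * ρ ≤ K := Nat.le_ceil _
  have hK2 : (K : ℝ) ≤ 17 * m ^ 2 * ρ := by
    have := Nat.ceil_lt_add_one (show 0 ≤ 16 * (m : ℝ) ^ 2 * ρ by positivity)
    linarith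
  have hK3 : (2 : ℝ) ≤ K := by linarith
  have hKpos : (0 : ℝ) < K := by linarith
  have hlogK : Real.log K ≤ C * T := (Real.log_le_log hKpos hK2).trans hC
  have hCT : 0 < C * T := (Real.log_pos (by linarith)).trans_le hlogK
  have hmCT : 0 < m * (C * T) := by positivity
  -- The largest choice for which `C * T ≥ log K` guarantees `r * m * log K ≤ L`. Since `r ≥ 1`,
  -- rounding down loses at most a factor 2.
  set r := ⌊L / (m * (C * T))⌋₊ with hr
  have h1 : 1 ≤ L / (m * (C * T)) := by rwa [one_le_div hmCT]
  have hr1 : 1 ≤ r := by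
    rw [hr, Nat.one_le_floor_iff]
    exact h1
  have hr1' : (1 : ℝ) ≤ r := by exact_mod_cast hr1
  have hrle : (r : ℝ) ≤ L / (m * (C * T)) := Nat.floor_le (by linarith)
  have hrlt : L / (m * (C * T)) < r + 1 := Nat.lt_floor_add_one _
  refine ⟨K, r, by exact_mod_cast hK3, hr1, ?_, hK1, ?_⟩
  · have hlog : ((r * m : ℕ) : ℝ) * Real.log K ≤ Real.log N := by
      rw [← hL]
      push_cast
      rw [le_div_iff₀ hmCT] at hrle
      calc (r : ℝ) * m * Real.log K ≤ r * m * (C * T) := by gcongr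
        _ ≤ L := by linarith
    rw [← Real.log_pow] at hlog
    have := (Real.log_le_log_iff (by positivity) (by positivity)).1 hlog
    exact_mod_cast this
  · rw [div_lt_iff₀ hmCT] at hrlt
    nlinarith

theorem theorem5 :
    ∀ ε₀ : ℝ, 0 < ε₀ → ε₀ < 1 →
      ∃ c : ℝ, 0 < c ∧
        ∀ N : ℕ, 3 ≤ N → ∀ ε : ℝ, 0 < ε → ε ≤ ε₀ →
          ∃ Dstar : PMF (Fin N), PairCond.FullSupport Dstar ∧
            ∀ (A : PairCond.Alg N) (q : ℕ),
              PairCond.IsIdentityTester A Dstar ε → A.MakesAtMost q →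
                c * (Real.sqrt (Real.log N / Real.log (ε⁻¹ * Real.log N)) * (ε ^ 2)⁻¹) ≤ (q : ℝ) := by
  intro ε₀ hε₀ hε₀1
  obtain ⟨m', hm'⟩ := exists_nat_gt (2 / (1 - ε₀))
  -- Enough buckets per group for every `ε ≤ ε₀` to be reached: `(1 - 1 / m) ^ 2 ≥ 1 - 2 * p = ε₀`.
  obtain ⟨m, hm2, hmε⟩ : ∃ m : ℕ, 2 ≤ m ∧ (m : ℝ)⁻¹ ≤ (1 - ε₀) / 2 := by
    have h1 : 0 < 1 - ε₀ := by linarith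
    refine ⟨max m' 2, le_max_right _ _, ?_⟩
    have h2 : 2 / (1 - ε₀) ≤ ((max m' 2 : ℕ) : ℝ) :=
      hm'.le.trans (by exact_mod_cast le_max_left _ _)
    calc ((max m' 2 : ℕ) : ℝ)⁻¹ ≤ (2 / (1 - ε₀))⁻¹ := inv_anti₀ (by positivity) h2
      _ = _ := inv_div _ _
  have hm0 : (2 : ℝ) ≤ m := by exact_mod_cast hm2
  set p := (1 - ε₀) / 2 with hp
  have hp0 : 0 < p := by rw [hp]; linarith
  set ℓ := Real.log ε₀⁻¹ with hℓ
  have hℓ0 : 0 < ℓ := Real.log_pos ((one_lt_inv₀ hε₀).2 hε₀1)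
  set C := Real.log (17 * m ^ 2) / ℓ + 2 with hC
  have hlogm : 0 ≤ Real.log (17 * (m : ℝ) ^ 2) := Real.log_nonneg (by nlinarith)
  have hC0 : 2 ≤ C := by
    have : 0 ≤ Real.log (17 * (m : ℝ) ^ 2) / ℓ := by positivity
    linarith
  -- The constant of the theorem is `√a`. The bound by `ℓ` gives the a priori estimate of `q`; the
  -- next serves small `log N`, the last the bucket construction.
  obtain ⟨a, ha0, haℓ, hap, ham⟩ : ∃ a : ℝ, 0 < a ∧ a ≤ ℓ ∧ a * (m * C) ≤ (p ^ 4 / 128) ^ 2 ∧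
      a * (32 * m ^ 3 * C) ≤ 1 / 100 := by
    refine ⟨min ℓ (min ((p ^ 4 / 128) ^ 2 / (m * C)) (1 / 100 / (32 * m ^ 3 * C))),
      by positivity, min_le_left _ _, ?_, ?_⟩
    · rw [← le_div_iff₀ (by positivity)]
      exact (min_le_right _ _).trans (min_le_left _ _)
    · rw [← le_div_iff₀ (by positivity)]
      exact (min_le_right _ _).trans (min_le_right _ _)
  refine ⟨Real.sqrt a, Real.sqrt_pos.2 ha0, fun N hN ε hε hεε₀ => ?_⟩
  set L := Real.log N with hL
  have hL1 : 1 < L := by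
    rw [hL, Real.lt_log_iff_exp_lt (by positivity)]
    have h3 : (3 : ℝ) ≤ N := by exact_mod_cast hN
    linarith [Real.exp_one_lt_d9]
  set T := Real.log (ε⁻¹ * L) with hT
  have hεinv : ε₀⁻¹ ≤ ε⁻¹ := inv_anti₀ hε hεε₀
  have hε₀inv : 1 < ε₀⁻¹ := (one_lt_inv₀ hε₀).2 hε₀1
  have hεL : ε₀⁻¹ ≤ ε⁻¹ * L := hεinv.trans (le_mul_of_one_le_right (by positivity) hL1.le)
  have hTℓ : ℓ ≤ T := Real.log_le_log (by positivity) hεL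
  have hT0 : 0 < T := hℓ0.trans_le hTℓ
  have hρ : 1 ≤ (ε⁻¹ * L) ^ 2 := one_le_pow₀ (hε₀inv.le.trans hεL)
  have hlogρ : Real.log (17 * m ^ 2 * (ε⁻¹ * L) ^ 2) ≤ C * T := by
    rw [Real.log_mul (by positivity) (by positivity), Real.log_pow, ← hT, hC, add_mul]
    have : Real.log (17 * (m : ℝ) ^ 2) ≤ Real.log (17 * (m : ℝ) ^ 2) / ℓ * T := by
      rw [div_mul_eq_mul_div, le_div_iff₀ hℓ0]
      exact mul_le_mul_of_nonneg_left hTℓ hlogm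
    push_cast
    linarith
  have hbound : ∀ q : ℕ, (q : ℝ) < Real.sqrt a * (Real.sqrt (L / T) * (ε ^ 2)⁻¹) →
      (q * ε ^ 2) ^ 2 ≤ a * (L / T) := by
    intro q hq
    have h1 : q * ε ^ 2 ≤ Real.sqrt (a * (L / T)) := by
      rw [Real.sqrt_mul ha0.le]
      rw [← mul_assoc, ← div_eq_mul_inv, lt_div_iff₀ (by positivity)] at hq
      exact hq.le
    calc (q * ε ^ 2) ^ 2 ≤ Real.sqrt (a * (L / T)) ^ 2 :=
          pow_le_pow_left₀ (by positivity) h1 2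
      _ = _ := Real.sq_sqrt (by positivity)
  rcases le_or_gt (m * (C * T)) L with hcase | hcase
  · obtain ⟨K, r, hK2, hr1, hKN, hK, hr⟩ := exists_bucket_parameters (by omega) hL (by omega) hρ hlogρ
      hcase
    have hmε' : (m : ℝ)⁻¹ ≤ 1 / 2 := by
      rw [one_div]
      exact inv_anti₀ (by norm_num) hm0
    have hδ : 0 < 1 - (m : ℝ)⁻¹ := by linarith
    have hδm : ε / (1 - (m : ℝ)⁻¹) ≤ 1 - (m : ℝ)⁻¹ := by
      rw [div_le_iff₀ hδ]
      calc ε ≤ (1 - p) * (1 - p) := by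
            have h1 : (1 - p) * (1 - p) = 1 - 2 * p + p ^ 2 := by ring
            have h2 : 2 * p = 1 - ε₀ := by rw [hp]; ring
            linarith [sq_nonneg p]
        _ ≤ _ := mul_le_mul (by linarith) (by linarith) (by linarith) hδ.le
    obtain ⟨Dstar, hfull, hlow⟩ := PairCond.exists_lower_bound_of_pow_le hK2 hr1
      (by omega : 1 ≤ m) hKN (div_nonneg hε.le hδ.le) hδm
    rw [div_mul_cancel₀ _ hδ.ne'] at hlow
    refine ⟨Dstar, hfull, fun A q hA hq => ?_⟩
    by_contra! hcon
    have hb := hbound q hcon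
    -- `K` must exceed a multiple of `q` but is chosen before `q`. A tester violating the claim has
    -- `q * ε ^ 2 ≤ L ^ 2`, so this crude bound suffices.
    have hqρ : (q : ℝ) ≤ (ε⁻¹ * L) ^ 2 := by
      have h1 : a * (L / T) ≤ L := by
        rw [mul_div_assoc', div_le_iff₀ hT0, mul_comm]
        exact mul_le_mul_of_nonneg_left (haℓ.trans hTℓ) (by linarith)
      have h2 : q * ε ^ 2 ≤ L ^ 2 := by
        have h3 : (q * ε ^ 2) ^ 2 ≤ L ^ 2 := hb.trans (h1.trans (le_self_pow₀ hL1.le two_ne_zero))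
        have := (abs_le.1 (abs_le_of_sq_le_sq h3 (by linarith))).2
        exact this.trans (le_self_pow₀ hL1.le two_ne_zero)
      rw [mul_pow, inv_pow, mul_comm, ← div_eq_mul_inv, le_div_iff₀ (by positivity)]
      exact h2
    have hlt := hlow A q hA hq (by
      refine le_trans ?_ hK
      rw [mul_comm]
      exact mul_le_mul_of_nonneg_left hqρ (by positivity))
    have hδ2 : ε / (1 - (m : ℝ)⁻¹) ≤ 2 * ε := by
      rw [div_le_iff₀ hδ, mul_assoc, mul_comm, mul_assoc]
      exact le_mul_of_one_le_right hε.le (by linarith)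
    have h3 : (q * (ε / (1 - (m : ℝ)⁻¹)) ^ 2 * m) ^ 2 ≤ (q * (2 * ε) ^ 2 * m) ^ 2 := by
      gcongr
    have h4 : (q * (2 * ε) ^ 2 * m) ^ 2 = 16 * m ^ 2 * (q * ε ^ 2) ^ 2 := by ring
    have h5 : a * (L / T) ≤ a * (2 * m * C * r) := by
      refine mul_le_mul_of_nonneg_left ?_ ha0.le
      rw [div_le_iff₀ hT0]
      linarith
    have h6 : 16 * m ^ 2 * (q * ε ^ 2) ^ 2 ≤ 16 * (m : ℝ) ^ 2 * (a * (2 * m * C * r)) := by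
      gcongr
      exact hb.trans h5
    have h7 : 16 * (m : ℝ) ^ 2 * (a * (2 * m * C * r)) = a * (32 * m ^ 3 * C) * r := by ring
    have h8 : a * (32 * m ^ 3 * C) * r ≤ 1 / 100 * r := by gcongr
    linarith
  · obtain ⟨Dstar, hfull, hlow⟩ := PairCond.exists_lower_bound_of_two_le (N := N) (by omega) hp0 hε
      (by rw [hp]; linarith)
    refine ⟨Dstar, hfull, fun A q hA hq => ?_⟩
    by_contra! hcon
    have hb := hbound q hcon
    have hlt := hlow A q hA hq
    have h1 : L / T ≤ m * C := by
      rw [div_le_iff₀ hT0]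
      linarith
    have h2 : (q * ε ^ 2) ^ 2 ≤ (p ^ 4 / 128) ^ 2 :=
      hb.trans ((mul_le_mul_of_nonneg_left h1 ha0.le).trans hap)
    have h3 := abs_le_of_sq_le_sq h2 (by positivity)
    linarith [(abs_le.1 h3).2]
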